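/- Let $n \ge 0$, $C_0 \ge 10$, $k > 1$, $k_0 \ge 1$ and $\delta > 0$. There is a finite constant $C$, depending only on $n, C_0, k, k_0, \delta$, with the following property. Let $\mu$ be a Borel measure on $\mathbb{R}^n$ such that $\mu(B(0,2)) \ge 1$, $\mu(\mathbb{R}^n \setminus B(0,2)) = 0$, and $\mu(B(x,t)) \le 2 C_0 t$ for all $x \in \mathbb{R}^n$, $t>0$, where $B(x,t)$ denotes the closed ball. For $x \in \mathbb{R}^n$ and $t > 0$ put $$\delta(x,t) = \frac{\mu(B(x,t))}{t}, \qquad \tilde\delta(x,t) = \sup_{y \in B(x,k_0t)} \delta(y,t), \qquad \beta_1(x,t) = \inf_D \frac1t \int_{B(x,kt)} \frac{d(y,D)}{t}\, d\mu(y),$$ the infimum being taken over all lines $D$ of $\mathbb{R}^n$, and let $$c^2(\mu) = \iiint c(x,y,z)^2 \, d\mu(x)\, d\mu(y)\, d\mu(z) \in [0,\infty],$$ where $c(x,y,z)$ is the Menger curvature, that is, the inverse of the radius of the circle through $x,y,z$ (and $0$ if the three points are collinear or not distinct). Then $$\int \int_0^\infty \beta_1(x,t)^2\, \mathbb{1}_{\{\delta(x,t)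 \ge \delta\}} \, \frac{dt}{t}\, d\mu(x) \le C\, c^2(\mu),$$ and, with the same constant, also $$\int \int_0^\infty \beta_1(x,t)^2\, \mathbb{1}_{\{\tilde\delta(x,t) \ge \delta\}} \, \frac{dt}{t}\, d\mu(x) \le C\, c^2(\mu).$$ -/

import Mathlib

open MeasureTheory Set

noncomputable section

namespace Menger

/-- The Menger curvature `c(x, y, z)` of three points of `ℝⁿ`: the inverse of the radius of the
circle through them when they are vertices of a nondegenerate triangle, and `0` when they are
collinear (the circle being then a line, of infinite radius). For triples in which two points
coincide, where no circle is determined, the value is set to `0`. -/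
def curvature {n : ℕ} (x y z : EuclideanSpace ℝ (Fin n)) : ℝ :=
  open Classical in
  if h : AffineIndependent ℝ ![x, y, z] then
    (Affine.Simplex.circumradius (⟨![x, y, z], h⟩ : Affine.Triangle ℝ (EuclideanSpace ℝ (Fin n))))⁻¹
  else 0

/-- The squared total Menger curvature `c²(μ) = ∫∫∫ c(x, y, z)² dμ(x) dμ(y) dμ(z)`, a number in
`[0, ∞]`. -/
def totalCurvatureSq {n : ℕ} (μ : Measure (EuclideanSpace ℝ (Fin n))) : ENNReal :=
  ∫⁻ x, ∫⁻ y, ∫⁻ z, ENNReal.ofReal (curvature x y z ^ 2) ∂μ ∂μ ∂μ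

/-- The density `δ(x, t) = μ(B(x, t)) / t`; all balls are closed. -/
def density {n : ℕ} (μ : Measure (EuclideanSpace ℝ (Fin n)))
    (x : EuclideanSpace ℝ (Fin n)) (t : ℝ) : ENNReal :=
  μ (Metric.closedBall x t) / ENNReal.ofReal t

/-- The enlarged density: the supremum of `δ(y, t)` over `y ∈ B(x, k₀ t)`. -/
def maxDensity {n : ℕ} (μ : Measure (EuclideanSpace ℝ (Fin n))) (k₀ : ℝ)
    (x : EuclideanSpace ℝ (Fin n)) (t : ℝ) : ENNReal :=
  ⨆ y ∈ Metric.closedBall x (k₀ * t), density μ y t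

/-- `D` is a line: a one-dimensional affine subspace. -/
def IsLine {n : ℕ} (D : AffineSubspace ℝ (EuclideanSpace ℝ (Fin n))) : Prop :=
  Module.finrank ℝ D.direction = 1

/-- `β₁^D(x, t) = (1/t) ∫_{B(x, kt)} d(y, D)/t dμ(y)`. -/
def betaOneLine {n : ℕ} (μ : Measure (EuclideanSpace ℝ (Fin n))) (k : ℝ)
    (D : AffineSubspace ℝ (EuclideanSpace ℝ (Fin n)))
    (x : EuclideanSpace ℝ (Fin n)) (t : ℝ) : ENNReal :=
  (∫⁻ y in Metric.closedBall x (k * t),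
    ENNReal.ofReal (Metric.infDist y (D : Set (EuclideanSpace ℝ (Fin n))) / t) ∂μ)
      / ENNReal.ofReal t

/-- Jones' number `β₁(x, t)`: the infimum of `β₁^D(x, t)` over all lines `D`. -/
def betaOne {n : ℕ} (μ : Measure (EuclideanSpace ℝ (Fin n))) (k : ℝ)
    (x : EuclideanSpace ℝ (Fin n)) (t : ℝ) : ENNReal :=
  ⨅ (D : AffineSubspace ℝ (EuclideanSpace ℝ (Fin n))) (_ : IsLine D), betaOneLine μ k D x t

end Menger

end

/-!
For points `a`, `b` at distance `≳ t`, the line `D` through them satisfies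
`d(z, D) = c(a, b, z) |z - a| |z - b| / 2`, so `β₁^D(x, t)² ≲ t ∫ c(a, b, z)² dμ(z)` by
Cauchy-Schwarz and linear growth. If some ball `B(y, t)` near `x` has mass `≳ t`, then linear growth
also forces the pairs `(a, b) ∈ B(y, t)²` at distance `≳ t` to have `μ × μ`-mass `≳ t²`; averaging
over them bounds `β₁(x, t)² / t` by `t⁻²` times the integral of `c(a, b, z)²` over such pairs. By
Tonelli it remains to see that a pair `(a, b)` is counted with bounded total weight: it only meets
scales `t ≈ |a - b|`, and at each of them a set of `x` of mass `≲ t`.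
-/

namespace Menger

open EuclideanGeometry Metric

lemma sq_lintegral_le_measure_univ_mul {α : Type*} [MeasurableSpace α] {μ : Measure α}
    {f : α → ENNReal} (hf : AEMeasurable f μ) :
    (∫⁻ x, f x ∂μ) ^ 2 ≤ μ univ * ∫⁻ x, f x ^ 2 ∂μ := by
  have h := ENNReal.lintegral_mul_le_Lp_mul_Lq μ Real.HolderConjugate.two_two hf
    (aemeasurable_const (b := (1 : ENNReal)))
  simp only [Pi.mul_apply, mul_one, ENNReal.rpow_ofNat, one_pow, lintegral_one] at h
  refine (pow_le_pow_left₀ zero_le h 2).trans_eq ?_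
  rw [mul_pow, ← ENNReal.rpow_mul_natCast, ← ENNReal.rpow_mul_natCast]
  norm_num [mul_comm]

section Triangle

variable {V P : Type*} [NormedAddCommGroup V] [InnerProductSpace ℝ V] [MetricSpace P]
  [NormedAddTorsor V P]

/-- Twice the area of the triangle `x y z`. The law of sines makes the Menger curvature twice this
quantity divided by the product of the side lengths. -/
noncomputable def doubleArea (x y z : P) : ℝ :=
  dist x y * dist x z * Real.sin (∠ y x z)

lemma doubleArea_eq_sqrt (x y z : P) :
    doubleArea x y z = √(inner ℝ (y -ᵥ x) (y -ᵥ x) * inner ℝ (z -ᵥ x) (z -ᵥ x) -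
      inner ℝ (y -ᵥ x) (z -ᵥ x) * inner ℝ (y -ᵥ x) (z -ᵥ x)) := by
  rw [← InnerProductGeometry.sin_angle_mul_norm_mul_norm, doubleArea, EuclideanGeometry.angle,
    dist_comm x y, dist_comm x z, dist_eq_norm_vsub V y, dist_eq_norm_vsub V z]
  ring

lemma continuous_doubleArea : Continuous fun p : P × P × P => doubleArea p.1 p.2.1 p.2.2 := by
  simp only [doubleArea_eq_sqrt]
  fun_prop

lemma doubleArea_eq_zero_of_collinear {x y z : P} (h : Collinear ℝ {x, y, z}) :
    doubleArea x y z = 0 := by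
  rw [insert_comm, collinear_iff_eq_or_eq_or_sin_eq_zero] at h
  rcases h with rfl | rfl | h <;> simp [doubleArea, *]

lemma infDist_line_mul_dist_le_doubleArea (x y z : P) :
    infDist z (line[ℝ, x, y] : Set P) * dist x y ≤ doubleArea x y z := by
  rcases eq_or_ne x y with rfl | hxy
  · simp [doubleArea]
  set u := y -ᵥ x with hu
  set v := z -ᵥ x
  have hu0 : ‖u‖ ≠ 0 := by simpa [hu] using hxy.symm
  set s : ℝ := inner ℝ u v / ‖u‖ ^ 2 with hs
  have hdist : infDist z (line[ℝ, x, y] : Set P) ≤ ‖v - s • u‖ := by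
    refine (infDist_le_dist_of_mem (AffineMap.lineMap_mem_affineSpan_pair s x y)).trans_eq ?_
    rw [dist_eq_norm_vsub V, AffineMap.lineMap_apply, vsub_vadd_eq_vsub_sub]
  have hfoot : (‖v - s • u‖ * ‖u‖) ^ 2 =
      inner ℝ u u * inner ℝ v v - inner ℝ u v * inner ℝ u v := by
    rw [mul_pow, norm_sub_sq_real, real_inner_smul_right, norm_smul, mul_pow, Real.norm_eq_abs,
      sq_abs, real_inner_comm u v, hs, real_inner_self_eq_norm_sq, real_inner_self_eq_norm_sq]
    field_simp
    ring
  rw [doubleArea_eq_sqrt, ← hfoot, Real.sqrt_sq (by positivity), dist_comm x y,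
    dist_eq_norm_vsub V y x]
  gcongr

end Triangle

section Curvature

variable {n : ℕ}

lemma curvature_eq (x y z : EuclideanSpace ℝ (Fin n)) :
    curvature x y z = 2 * doubleArea x y z / (dist x y * dist x z * dist y z) := by
  classical
  by_cases h : AffineIndependent ℝ ![x, y, z]
  · have hxy : x ≠ y := by simpa using h.injective.ne (show (0 : Fin 3) ≠ 1 by decide)
    have hxz : x ≠ z := by simpa using h.injective.ne (show (0 : Fin 3) ≠ 2 by decide)
    have law_of_sines : dist y z / Real.sin (∠ y x z) = 2 * Affine.Simplex.circumradius
        (⟨![x, y, z], h⟩ : Affine.Triangle ℝ (EuclideanSpace ℝ (Fin n))) :=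
      Affine.Triangle.dist_div_sin_angle_eq_two_mul_circumradius ⟨![x, y, z], h⟩
        (i₁ := 1) (i₂ := 0) (i₃ := 2) (by decide) (by decide) (by decide)
    have hxy' := dist_ne_zero.2 hxy
    have hxz' := dist_ne_zero.2 hxz
    rw [curvature, dif_pos h, ← mul_div_cancel_left₀ (Affine.Simplex.circumradius _)
      two_ne_zero, ← law_of_sines, doubleArea]
    field_simp
  · have hcol : Collinear ℝ {x, y, z} := by
      rwa [affineIndependent_iff_not_collinear_set, not_not] at h
    rw [curvature, dif_neg h, doubleArea_eq_zero_of_collinear hcol, mul_zero, zero_div]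

lemma curvature_nonneg (x y z : EuclideanSpace ℝ (Fin n)) : 0 ≤ curvature x y z := by
  rw [curvature_eq, doubleArea_eq_sqrt]
  positivity

lemma measurable_curvature : Measurable
    fun p : EuclideanSpace ℝ (Fin n) × EuclideanSpace ℝ (Fin n) × EuclideanSpace ℝ (Fin n) =>
      curvature p.1 p.2.1 p.2.2 := by
  simp only [curvature_eq]
  exact (continuous_doubleArea.measurable.const_mul 2).div
    (Continuous.measurable (by fun_prop))

lemma infDist_line_le_curvature_mul {x y : EuclideanSpace ℝ (Fin n)} (hxy : x ≠ y)
    (z : EuclideanSpace ℝ (Fin n)) :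
    infDist z (line[ℝ, x, y] : Set (EuclideanSpace ℝ (Fin n))) ≤
      curvature x y z * dist x z * dist y z / 2 := by
  rcases eq_or_ne x z with rfl | hxz
  · rw [infDist_zero_of_mem (left_mem_affineSpan_pair ℝ x y)]; simp
  rcases eq_or_ne y z with rfl | hyz
  · rw [infDist_zero_of_mem (right_mem_affineSpan_pair ℝ x y)]; simp
  have hxz' := dist_ne_zero.2 hxz
  have hyz' := dist_ne_zero.2 hyz
  have key : curvature x y z * dist x z * dist y z / 2 = doubleArea x y z / dist x y := by
    rw [curvature_eq]
    field_simp
  rw [key, le_div_iff₀ (dist_pos.2 hxy)]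
  exact infDist_line_mul_dist_le_doubleArea x y z

lemma isLine_line {x y : EuclideanSpace ℝ (Fin n)} (hxy : x ≠ y) : IsLine line[ℝ, x, y] := by
  rw [IsLine, direction_affineSpan, vectorSpan_pair]
  exact finrank_span_singleton (vsub_ne_zero.2 hxy)

/-- The squared Menger curvature of the pair `p` integrated over the third vertex. -/
noncomputable def pairCurvatureSq (μ : Measure (EuclideanSpace ℝ (Fin n)))
    (p : EuclideanSpace ℝ (Fin n) × EuclideanSpace ℝ (Fin n)) : ENNReal :=
  ∫⁻ z, ENNReal.ofReal (curvature p.1 p.2 z ^ 2) ∂μ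

variable {μ : Measure (EuclideanSpace ℝ (Fin n))}

lemma measurable_pairCurvatureSq [SFinite μ] : Measurable (pairCurvatureSq μ) := by
  have hassoc : Measurable fun q : (EuclideanSpace ℝ (Fin n) × EuclideanSpace ℝ (Fin n)) ×
      EuclideanSpace ℝ (Fin n) => (q.1.1, q.1.2, q.2) := by fun_prop
  exact ((measurable_curvature.comp hassoc).pow_const 2).ennreal_ofReal.lintegral_prod_right'

lemma lintegral_pairCurvatureSq [SFinite μ] :
    ∫⁻ p, pairCurvatureSq μ p ∂(μ.prod μ) = totalCurvatureSq μ :=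
  lintegral_prod _ measurable_pairCurvatureSq.aemeasurable

end Curvature

section LinearGrowth

variable {X : Type*} [PseudoMetricSpace X] [MeasurableSpace X]

/-- `μ` has linear growth with constant `L`: every closed ball of radius `t > 0` has measure at
most `L t`. -/
def HasLinearGrowth (μ : Measure X) (L : ℝ) : Prop :=
  ∀ (x : X) (t : ℝ), 0 < t → μ (closedBall x t) ≤ ENNReal.ofReal (L * t)

lemma HasLinearGrowth.isLocallyFiniteMeasure {μ : Measure X} {L : ℝ} (hμ : HasLinearGrowth μ L) :
    IsLocallyFiniteMeasure μ :=
  ⟨fun x => ⟨closedBall x 1, closedBall_mem_nhds x one_pos,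
    (hμ x 1 one_pos).trans_lt ENNReal.ofReal_lt_top⟩⟩

end LinearGrowth

section SeparatedPairs

variable {X : Type*} [PseudoMetricSpace X]

/-- Pairs of points of the closed ball `B(x, R)` whose mutual distance exceeds `r`. -/
def separatedPairs (x : X) (R r : ℝ) : Set (X × X) :=
  {p | p.1 ∈ closedBall x R ∧ p.2 ∈ closedBall x R ∧ r < dist p.1 p.2}

lemma separatedPairs_subset_of_closedBall_subset {x y : X} {R S r : ℝ}
    (h : closedBall y S ⊆ closedBall x R) : separatedPairs y S r ⊆ separatedPairs x R r :=
  fun _ hp => ⟨h hp.1, h hp.2.1, hp.2.2⟩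

lemma dist_le_two_mul_of_mem_separatedPairs {x : X} {R r : ℝ} {p : X × X}
    (hp : p ∈ separatedPairs x R r) : dist p.1 p.2 ≤ 2 * R := by
  linarith [dist_triangle_right p.1 p.2 x, mem_closedBall.1 hp.1, mem_closedBall.1 hp.2.1]

variable [MeasurableSpace X] [OpensMeasurableSpace X] [SecondCountableTopology X]

lemma measurableSet_setOf_mem_separatedPairs :
    MeasurableSet {w : (X × ℝ × ℝ) × X × X | w.2 ∈ separatedPairs w.1.1 w.1.2.1 w.1.2.2} := by
  have hball {f : (X × ℝ × ℝ) × X × X → X} (hf : Measurable f) :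
      MeasurableSet {w | f w ∈ closedBall w.1.1 w.1.2.1} :=
    measurableSet_le (hf.dist (by fun_prop)) (by fun_prop)
  have hsep : MeasurableSet {w : (X × ℝ × ℝ) × X × X | w.1.2.2 < dist w.2.1 w.2.2} :=
    measurableSet_lt (by fun_prop) (by fun_prop)
  exact (hball (by fun_prop)).inter ((hball (by fun_prop)).inter hsep)

lemma measurableSet_separatedPairs (x : X) (R r : ℝ) : MeasurableSet (separatedPairs x R r) :=
  measurableSet_setOf_mem_separatedPairs.preimage (measurable_prodMk_left (x := (x, R, r)))

variable {μ : Measure X}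

lemma measure_mul_half_le_prod_separatedPairs [SFinite μ] {y : X} {t r : ℝ}
    (hfin : μ (closedBall y t) ≠ ⊤)
    (hsmall : ∀ a ∈ closedBall y t, μ (closedBall a r) ≤ μ (closedBall y t) / 2) :
    μ (closedBall y t) * (μ (closedBall y t) / 2) ≤ (μ.prod μ) (separatedPairs y t r) := by
  have hslice : ∀ a ∈ closedBall y t,
      μ (closedBall y t) / 2 ≤ μ (Prod.mk a ⁻¹' separatedPairs y t r) := by
    intro a ha
    calc μ (closedBall y t) / 2 = μ (closedBall y t) - μ (closedBall y t) / 2 :=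
          (ENNReal.sub_half hfin).symm
      _ ≤ μ (closedBall y t) - μ (closedBall a r) := tsub_le_tsub_left (hsmall a ha) _
      _ ≤ μ (closedBall y t \ closedBall a r) := le_measure_sdiff
      _ ≤ μ (Prod.mk a ⁻¹' separatedPairs y t r) := measure_mono fun b hb =>
          ⟨ha, hb.1, by simpa only [mem_closedBall', not_le] using hb.2⟩
  calc μ (closedBall y t) * (μ (closedBall y t) / 2)
      = ∫⁻ _ in closedBall y t, μ (closedBall y t) / 2 ∂μ := by
        rw [setLIntegral_const, mul_comm]
    _ ≤ ∫⁻ a in closedBall y t, μ (Prod.mk a ⁻¹' separatedPairs y t r) ∂μ :=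
        setLIntegral_mono' isClosed_closedBall.measurableSet hslice
    _ ≤ ∫⁻ a, μ (Prod.mk a ⁻¹' separatedPairs y t r) ∂μ := setLIntegral_le_lintegral _ _
    _ = (μ.prod μ) (separatedPairs y t r) :=
        (Measure.prod_apply (measurableSet_separatedPairs y t r)).symm

lemma HasLinearGrowth.ofReal_le_prod_separatedPairs {L η t : ℝ} (hμ : HasLinearGrowth μ L)
    (hL : 0 < L) (hη : 0 < η) (ht : 0 < t) {y : X}
    (hy : ENNReal.ofReal (η * t) ≤ μ (closedBall y t)) :
    ENNReal.ofReal (η ^ 2 * t ^ 2 / 2) ≤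
      (μ.prod μ) (separatedPairs y t (η / (2 * L) * t)) := by
  have := hμ.isLocallyFiniteMeasure
  have hhalf : ∀ m : ℝ, ENNReal.ofReal (m / 2) = ENNReal.ofReal m / 2 := fun m => by
    rw [ENNReal.ofReal_div_of_pos two_pos, ENNReal.ofReal_ofNat]
  have hsmall : ∀ a ∈ closedBall y t,
      μ (closedBall a (η / (2 * L) * t)) ≤ μ (closedBall y t) / 2 := by
    intro a _
    calc μ (closedBall a (η / (2 * L) * t)) ≤ ENNReal.ofReal (L * (η / (2 * L) * t)) :=
          hμ a _ (by positivity)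
      _ = ENNReal.ofReal (η * t) / 2 := by
          rw [← hhalf]
          congr 1
          field_simp
      _ ≤ μ (closedBall y t) / 2 := by gcongr
  calc ENNReal.ofReal (η ^ 2 * t ^ 2 / 2)
      = ENNReal.ofReal (η * t) * (ENNReal.ofReal (η * t) / 2) := by
        rw [← hhalf, ← ENNReal.ofReal_mul (by positivity)]
        congr 1
        ring
    _ ≤ μ (closedBall y t) * (μ (closedBall y t) / 2) := by gcongr
    _ ≤ (μ.prod μ) (separatedPairs y t (η / (2 * L) * t)) :=
        measure_mul_half_le_prod_separatedPairs
          ((hμ y t ht).trans_lt ENNReal.ofReal_lt_top).ne hsmall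

end SeparatedPairs

lemma lintegral_lintegral_mul_setLIntegral_swap {α β γ : Type*} [MeasurableSpace α]
    [MeasurableSpace β] [MeasurableSpace γ] {μ : Measure α} {ν : Measure β} {ρ : Measure γ}
    [SFinite μ] [SFinite ν] [SFinite ρ] {W : Set ((α × β) × γ)} (hW : MeasurableSet W)
    {g : β → ENNReal} (hg : Measurable g) {Q : γ → ENNReal} (hQ : Measurable Q) :
    ∫⁻ x, ∫⁻ t, g t * ∫⁻ p in {p | ((x, t), p) ∈ W}, Q p ∂ρ ∂ν ∂μ =
      ∫⁻ p, Q p * ∫⁻ t, g t * μ {x | ((x, t), p) ∈ W} ∂ν ∂ρ := by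
  set F : α × β → γ → ENNReal := fun w p => g w.2 * W.indicator 1 (w, p) * Q p
  have hF : Measurable (Function.uncurry F) :=
    ((hg.comp (measurable_snd.comp measurable_fst)).mul (measurable_one.indicator hW)).mul
      (hQ.comp measurable_snd)
  calc ∫⁻ x, ∫⁻ t, g t * ∫⁻ p in {p | ((x, t), p) ∈ W}, Q p ∂ρ ∂ν ∂μ
      = ∫⁻ x, ∫⁻ t, ∫⁻ p, F (x, t) p ∂ρ ∂ν ∂μ := by
        congr with x
        congr with t
        have hslice : MeasurableSet {p | ((x, t), p) ∈ W} := measurable_prodMk_left hW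
        rw [← lintegral_indicator hslice, ← lintegral_const_mul _ (hQ.indicator hslice)]
        congr with p
        by_cases hp : ((x, t), p) ∈ W <;> simp [F, hp]
    _ = ∫⁻ w, ∫⁻ p, F w p ∂ρ ∂(μ.prod ν) :=
        (lintegral_prod _ hF.lintegral_prod_right'.aemeasurable).symm
    _ = ∫⁻ p, ∫⁻ w, F w p ∂(μ.prod ν) ∂ρ := lintegral_lintegral_swap hF.aemeasurable
    _ = ∫⁻ p, ∫⁻ t, ∫⁻ x, F (x, t) p ∂μ ∂ν ∂ρ := by
        congr with p
        exact lintegral_prod_symm _ hF.of_uncurry_right.aemeasurable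
    _ = ∫⁻ p, Q p * ∫⁻ t, g t * μ {x | ((x, t), p) ∈ W} ∂ν ∂ρ := by
        congr with p
        have hslice : MeasurableSet {w | (w, p) ∈ W} := measurable_prodMk_right hW
        have hmass : Measurable fun t => g t * μ {x | ((x, t), p) ∈ W} :=
          hg.mul (measurable_measure_prodMk_right hslice)
        rw [← lintegral_const_mul _ hmass]
        congr with t
        have hslice' : MeasurableSet {x | ((x, t), p) ∈ W} := measurable_prodMk_right hslice
        rw [← mul_assoc, ← lintegral_indicator_one hslice',
          ← lintegral_const_mul _ (measurable_one.indicator hslice')]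
        congr with x
        by_cases hp : ((x, t), p) ∈ W <;> simp [F, hp, mul_comm]

section Scales

variable {X : Type*} [PseudoMetricSpace X] [MeasurableSpace X] {μ : Measure X} {K L c : ℝ}

lemma HasLinearGrowth.div_sq_mul_measure_mem_separatedPairs_le_indicator (hμ : HasLinearGrowth μ L)
    (hK : 0 < K) (hL : 0 ≤ L) (hc : 0 < c) (p : X × X) {t : ℝ} (ht : 0 < t) :
    ENNReal.ofReal (1 / t ^ 2) * μ {x | p ∈ separatedPairs x (K * t) (c * t)} ≤
      (Ioc 0 (dist p.1 p.2 / c)).indicator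
        (fun _ => ENNReal.ofReal (2 * L * K ^ 2 / dist p.1 p.2)) t := by
  set A := {x | p ∈ separatedPairs x (K * t) (c * t)}
  rcases A.eq_empty_or_nonempty with hA | ⟨x₀, hx₀⟩
  · simp [hA]
  have hlower : c * t < dist p.1 p.2 := hx₀.2.2
  have hupper : dist p.1 p.2 ≤ 2 * (K * t) := dist_le_two_mul_of_mem_separatedPairs hx₀
  have hdist : 0 < dist p.1 p.2 := (mul_pos hc ht).trans hlower
  have hscale : t ∈ Ioc 0 (dist p.1 p.2 / c) := ⟨ht, by
    rw [le_div_iff₀ hc, mul_comm]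
    exact hlower.le⟩
  have hmass : μ A ≤ ENNReal.ofReal (L * (K * t)) :=
    (measure_mono fun x hx => mem_closedBall_comm.1 hx.1).trans (hμ p.1 (K * t) (by positivity))
  rw [indicator_of_mem hscale]
  calc ENNReal.ofReal (1 / t ^ 2) * μ A
      ≤ ENNReal.ofReal (1 / t ^ 2) * ENNReal.ofReal (L * (K * t)) := by gcongr
    _ = ENNReal.ofReal (L * K / t) := by
        rw [← ENNReal.ofReal_mul (by positivity)]
        congr 1
        field_simp
    _ ≤ ENNReal.ofReal (2 * L * K ^ 2 / dist p.1 p.2) := by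
        apply ENNReal.ofReal_le_ofReal
        rw [div_le_div_iff₀ ht hdist]
        calc L * K * dist p.1 p.2 ≤ L * K * (2 * (K * t)) := by gcongr
          _ = 2 * L * K ^ 2 * t := by ring

lemma HasLinearGrowth.lintegral_div_sq_mul_measure_mem_separatedPairs_le (hμ : HasLinearGrowth μ L)
    (hK : 0 < K) (hL : 0 ≤ L) (hc : 0 < c) (p : X × X) :
    ∫⁻ t in Ioi (0 : ℝ),
        ENNReal.ofReal (1 / t ^ 2) * μ {x | p ∈ separatedPairs x (K * t) (c * t)} ≤
      ENNReal.ofReal (2 * L * K ^ 2 / c) := by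
  set d := dist p.1 p.2
  have : 0 ≤ d := dist_nonneg
  calc ∫⁻ t in Ioi (0 : ℝ),
        ENNReal.ofReal (1 / t ^ 2) * μ {x | p ∈ separatedPairs x (K * t) (c * t)}
      ≤ ∫⁻ t in Ioi (0 : ℝ),
          (Ioc 0 (d / c)).indicator (fun _ => ENNReal.ofReal (2 * L * K ^ 2 / d)) t :=
        setLIntegral_mono' measurableSet_Ioi fun _ ht =>
          hμ.div_sq_mul_measure_mem_separatedPairs_le_indicator hK hL hc p ht
    _ ≤ ∫⁻ t, (Ioc 0 (d / c)).indicator (fun _ => ENNReal.ofReal (2 * L * K ^ 2 / d)) t :=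
        setLIntegral_le_lintegral _ _
    _ = ENNReal.ofReal (2 * L * K ^ 2 / d * (d / c)) := by
        rw [lintegral_indicator_const measurableSet_Ioc, Real.volume_Ioc, sub_zero,
          ← ENNReal.ofReal_mul (by positivity)]
    _ ≤ ENNReal.ofReal (2 * L * K ^ 2 / c) := by
        apply ENNReal.ofReal_le_ofReal
        rw [div_mul_div_comm, mul_comm d c]
        exact mul_div_mul_right_le (by positivity)

variable [OpensMeasurableSpace X] [SecondCountableTopology X]

lemma HasLinearGrowth.lintegral_setLIntegral_separatedPairs_le (hμ : HasLinearGrowth μ L)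
    (hK : 0 < K) (hL : 0 ≤ L) (hc : 0 < c) {Q : X × X → ENNReal} (hQ : Measurable Q) :
    ∫⁻ x, (∫⁻ t in Ioi (0 : ℝ), ENNReal.ofReal (1 / t ^ 2) *
        ∫⁻ p in separatedPairs x (K * t) (c * t), Q p ∂(μ.prod μ)) ∂μ ≤
      ENNReal.ofReal (2 * L * K ^ 2 / c) * ∫⁻ p, Q p ∂(μ.prod μ) := by
  have := hμ.isLocallyFiniteMeasure
  have hW : MeasurableSet
      {w : (X × ℝ) × X × X | w.2 ∈ separatedPairs w.1.1 (K * w.1.2) (c * w.1.2)} :=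
    measurableSet_setOf_mem_separatedPairs.preimage
      (f := fun w : (X × ℝ) × X × X => ((w.1.1, K * w.1.2, c * w.1.2), w.2)) (by fun_prop)
  calc _ = ∫⁻ p, Q p * (∫⁻ t in Ioi (0 : ℝ), ENNReal.ofReal (1 / t ^ 2) *
          μ {x | p ∈ separatedPairs x (K * t) (c * t)}) ∂(μ.prod μ) :=
        lintegral_lintegral_mul_setLIntegral_swap hW (by fun_prop) hQ
    _ ≤ ∫⁻ p, Q p * ENNReal.ofReal (2 * L * K ^ 2 / c) ∂(μ.prod μ) := by
        gcongr with p
        exact hμ.lintegral_div_sq_mul_measure_mem_separatedPairs_le hK hL hc p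
    _ = ENNReal.ofReal (2 * L * K ^ 2 / c) * ∫⁻ p, Q p ∂(μ.prod μ) := by
        rw [lintegral_mul_const _ hQ, mul_comm]

end Scales

section Beta

variable {n : ℕ} {μ : Measure (EuclideanSpace ℝ (Fin n))} {k R t : ℝ}
  {x a b : EuclideanSpace ℝ (Fin n)}

lemma betaOneLine_le (ht : 0 < t) (hkR : k * t ≤ R) (ha : a ∈ closedBall x R)
    (hb : b ∈ closedBall x R) (hab : a ≠ b) :
    betaOneLine μ k line[ℝ, a, b] x t ≤ ENNReal.ofReal (2 * R ^ 2 / t ^ 2) *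
      ∫⁻ z in closedBall x (k * t), ENNReal.ofReal (curvature a b z) ∂μ := by
  have hpointwise : ∀ z ∈ closedBall x (k * t),
      ENNReal.ofReal (infDist z (line[ℝ, a, b] : Set (EuclideanSpace ℝ (Fin n))) / t) ≤
        ENNReal.ofReal (2 * R ^ 2 / t) * ENNReal.ofReal (curvature a b z) := by
    intro z hz
    have hdiam : ∀ w ∈ closedBall x R, dist w z ≤ 2 * R := fun w hw => by
      linarith [dist_triangle_right w z x, mem_closedBall.1 hw, mem_closedBall.1 hz]
    have hR : 0 ≤ R := dist_nonneg.trans ha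
    have hcurv := curvature_nonneg a b z
    rw [← ENNReal.ofReal_mul (by positivity)]
    apply ENNReal.ofReal_le_ofReal
    rw [div_mul_eq_mul_div]
    gcongr
    calc infDist z (line[ℝ, a, b] : Set (EuclideanSpace ℝ (Fin n)))
        ≤ curvature a b z * dist a z * dist b z / 2 := infDist_line_le_curvature_mul hab z
      _ ≤ curvature a b z * (2 * R) * (2 * R) / 2 := by
          gcongr
          exacts [hdiam a ha, hdiam b hb]
      _ = 2 * R ^ 2 * curvature a b z := by ring
  refine ENNReal.div_le_of_le_mul ?_
  calc _ ≤ ∫⁻ z in closedBall x (k * t),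
          ENNReal.ofReal (2 * R ^ 2 / t) * ENNReal.ofReal (curvature a b z) ∂μ :=
        setLIntegral_mono' isClosed_closedBall.measurableSet hpointwise
    _ = ENNReal.ofReal (2 * R ^ 2 / t ^ 2 * t) *
          ∫⁻ z in closedBall x (k * t), ENNReal.ofReal (curvature a b z) ∂μ := by
        rw [lintegral_const_mul' _ _ ENNReal.ofReal_ne_top]
        congr 2
        field_simp
    _ = _ := by
        rw [ENNReal.ofReal_mul (by positivity)]
        ring

lemma betaOneLine_sq_le (ht : 0 < t) (hkR : k * t ≤ R) (ha : a ∈ closedBall x R)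
    (hb : b ∈ closedBall x R) (hab : a ≠ b) :
    betaOneLine μ k line[ℝ, a, b] x t ^ 2 ≤
      ENNReal.ofReal (4 * R ^ 4 / t ^ 4) * μ (closedBall x (k * t)) * pairCurvatureSq μ (a, b) := by
  have hmeas : Measurable fun z => ENNReal.ofReal (curvature a b z) :=
    (measurable_curvature.comp (f := fun z => (a, b, z)) (by fun_prop)).ennreal_ofReal
  have cauchy_schwarz :
      (∫⁻ z in closedBall x (k * t), ENNReal.ofReal (curvature a b z) ∂μ) ^ 2 ≤
        μ (closedBall x (k * t)) * pairCurvatureSq μ (a, b) := by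
    refine (sq_lintegral_le_measure_univ_mul hmeas.aemeasurable).trans ?_
    simp only [Measure.restrict_apply_univ, ← ENNReal.ofReal_pow (curvature_nonneg _ _ _)]
    gcongr
    exact setLIntegral_le_lintegral _ _
  calc betaOneLine μ k line[ℝ, a, b] x t ^ 2
      ≤ (ENNReal.ofReal (2 * R ^ 2 / t ^ 2) *
          ∫⁻ z in closedBall x (k * t), ENNReal.ofReal (curvature a b z) ∂μ) ^ 2 := by
        gcongr
        exact betaOneLine_le ht hkR ha hb hab
    _ ≤ ENNReal.ofReal (2 * R ^ 2 / t ^ 2) ^ 2 *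
          (μ (closedBall x (k * t)) * pairCurvatureSq μ (a, b)) := by
        rw [mul_pow]
        gcongr
    _ = _ := by
        rw [← ENNReal.ofReal_pow (by positivity), ← mul_assoc]
        congr 3
        ring

lemma betaOne_sq_mul_prod_separatedPairs_le [SFinite μ] {r : ℝ} (ht : 0 < t) (hkR : k * t ≤ R)
    (hr : 0 ≤ r) :
    betaOne μ k x t ^ 2 * (μ.prod μ) (separatedPairs x R r) ≤
      ENNReal.ofReal (4 * R ^ 4 / t ^ 4) * μ (closedBall x (k * t)) *
        ∫⁻ p in separatedPairs x R r, pairCurvatureSq μ p ∂(μ.prod μ) := by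
  have hpointwise : ∀ p ∈ separatedPairs x R r, betaOne μ k x t ^ 2 ≤
      ENNReal.ofReal (4 * R ^ 4 / t ^ 4) * μ (closedBall x (k * t)) * pairCurvatureSq μ p := by
    rintro ⟨a, b⟩ ⟨ha, hb, hr_lt⟩
    have hab : a ≠ b := dist_pos.1 (hr.trans_lt hr_lt)
    calc betaOne μ k x t ^ 2 ≤ betaOneLine μ k line[ℝ, a, b] x t ^ 2 := by
          gcongr
          exact iInf₂_le _ (isLine_line hab)
      _ ≤ _ := betaOneLine_sq_le ht hkR ha hb hab
  rw [← setLIntegral_const, ← lintegral_const_mul _ measurable_pairCurvatureSq]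
  exact setLIntegral_mono' (measurableSet_separatedPairs x R r) hpointwise

lemma HasLinearGrowth.betaOne_sq_div_le {K k₀ η L : ℝ} {y : EuclideanSpace ℝ (Fin n)}
    (hμ : HasLinearGrowth μ L) (hL : 0 < L) (hη : 0 < η) (hK : 0 < K) (hkK : k ≤ K)
    (hk₀K : k₀ + 1 ≤ K) (ht : 0 < t) (hyx : dist y x ≤ k₀ * t)
    (hy : ENNReal.ofReal (η * t) ≤ μ (closedBall y t)) :
    betaOne μ k x t ^ 2 / ENNReal.ofReal t ≤ ENNReal.ofReal (8 * K ^ 5 * L / η ^ 2) *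
      (ENNReal.ofReal (1 / t ^ 2) * ∫⁻ p in separatedPairs x (K * t) (η / (2 * L) * t),
        pairCurvatureSq μ p ∂(μ.prod μ)) := by
  have := hμ.isLocallyFiniteMeasure
  set S := separatedPairs x (K * t) (η / (2 * L) * t)
  set I := ∫⁻ p in S, pairCurvatureSq μ p ∂(μ.prod μ)
  have hkt : k * t ≤ K * t := by gcongr
  have hmass : ENNReal.ofReal (η ^ 2 * t ^ 2 / 2) ≤ (μ.prod μ) S :=
    (hμ.ofReal_le_prod_separatedPairs hL hη ht hy).trans <| measure_mono <|
      separatedPairs_subset_of_closedBall_subset <| closedBall_subset_closedBall' <| by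
        nlinarith
  have hgrowth : μ (closedBall x (k * t)) ≤ ENNReal.ofReal (L * (K * t)) :=
    (measure_mono (closedBall_subset_closedBall hkt)).trans (hμ x (K * t) (by positivity))
  have hprod : betaOne μ k x t ^ 2 * ENNReal.ofReal (η ^ 2 * t ^ 2 / 2) ≤
      ENNReal.ofReal (4 * K ^ 5 * L * t) * I := by
    calc betaOne μ k x t ^ 2 * ENNReal.ofReal (η ^ 2 * t ^ 2 / 2)
        ≤ betaOne μ k x t ^ 2 * (μ.prod μ) S := by gcongr
      _ ≤ ENNReal.ofReal (4 * (K * t) ^ 4 / t ^ 4) * μ (closedBall x (k * t)) * I :=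
          betaOne_sq_mul_prod_separatedPairs_le ht hkt (by positivity)
      _ ≤ ENNReal.ofReal (4 * (K * t) ^ 4 / t ^ 4) * ENNReal.ofReal (L * (K * t)) * I := by gcongr
      _ = ENNReal.ofReal (4 * K ^ 5 * L * t) * I := by
          rw [← ENNReal.ofReal_mul (by positivity)]
          congr 2
          field_simp
  have hpos : 0 < η ^ 2 * t ^ 2 / 2 := by positivity
  refine ENNReal.div_le_of_le_mul ?_
  calc betaOne μ k x t ^ 2
      ≤ ENNReal.ofReal (4 * K ^ 5 * L * t) * I / ENNReal.ofReal (η ^ 2 * t ^ 2 / 2) :=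
        (ENNReal.le_div_iff_mul_le (.inl (ENNReal.ofReal_pos.2 hpos).ne')
          (.inl ENNReal.ofReal_ne_top)).2 hprod
    _ = ENNReal.ofReal (8 * K ^ 5 * L / η ^ 2 * (1 / t ^ 2) * t) * I := by
        rw [ENNReal.mul_div_right_comm, ← ENNReal.ofReal_div_of_pos hpos]
        congr 2
        field_simp
        norm_num
    _ = _ := by
        rw [ENNReal.ofReal_mul (by positivity), ENNReal.ofReal_mul (by positivity)]
        ring

/-- The integral `∫∫ β₁(x, t)² 1_{t ∈ G(x)} dt/t dμ(x)` over a family `G` of sets of scales. -/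
noncomputable def betaOneIntegral (μ : Measure (EuclideanSpace ℝ (Fin n))) (k : ℝ)
    (G : EuclideanSpace ℝ (Fin n) → Set ℝ) : ENNReal :=
  ∫⁻ x, (∫⁻ t in Ioi (0 : ℝ),
    (G x).indicator (fun s => betaOne μ k x s ^ 2 / ENNReal.ofReal s) t) ∂μ

theorem HasLinearGrowth.betaOneIntegral_le {K k₀ η L : ℝ} (hμ : HasLinearGrowth μ L) (hL : 0 < L)
    (hη : 0 < η) (hK : 0 < K) (hkK : k ≤ K) (hk₀K : k₀ + 1 ≤ K)
    {G : EuclideanSpace ℝ (Fin n) → Set ℝ}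
    (hG : ∀ x, ∀ t ∈ G x, 0 < t →
      ∃ y ∈ closedBall x (k₀ * t), ENNReal.ofReal (η * t) ≤ μ (closedBall y t)) :
    betaOneIntegral μ k G ≤ ENNReal.ofReal (32 * K ^ 7 * L ^ 3 / η ^ 3) * totalCurvatureSq μ := by
  have := hμ.isLocallyFiniteMeasure
  set A := 8 * K ^ 5 * L / η ^ 2
  set c := η / (2 * L)
  have hpointwise : ∀ x, ∀ t ∈ Ioi (0 : ℝ),
      (G x).indicator (fun s => betaOne μ k x s ^ 2 / ENNReal.ofReal s) t ≤
        ENNReal.ofReal A * (ENNReal.ofReal (1 / t ^ 2) *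
          ∫⁻ p in separatedPairs x (K * t) (c * t), pairCurvatureSq μ p ∂(μ.prod μ)) := by
    refine fun x t ht => indicator_apply_le' (fun htG => ?_) (fun _ => zero_le)
    obtain ⟨y, hyx, hy⟩ := hG x t htG ht
    exact hμ.betaOne_sq_div_le hL hη hK hkK hk₀K ht hyx hy
  calc betaOneIntegral μ k G
      ≤ ∫⁻ x, (∫⁻ t in Ioi (0 : ℝ), ENNReal.ofReal A * (ENNReal.ofReal (1 / t ^ 2) *
          ∫⁻ p in separatedPairs x (K * t) (c * t), pairCurvatureSq μ p ∂(μ.prod μ))) ∂μ :=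
        lintegral_mono fun x => setLIntegral_mono' measurableSet_Ioi (hpointwise x)
    _ = ENNReal.ofReal A * ∫⁻ x, (∫⁻ t in Ioi (0 : ℝ), ENNReal.ofReal (1 / t ^ 2) *
          ∫⁻ p in separatedPairs x (K * t) (c * t), pairCurvatureSq μ p ∂(μ.prod μ)) ∂μ := by
        simp only [lintegral_const_mul' _ _ (ENNReal.ofReal_ne_top (r := A))]
    _ ≤ ENNReal.ofReal A * (ENNReal.ofReal (2 * L * K ^ 2 / c) * totalCurvatureSq μ) := by
        rw [← lintegral_pairCurvatureSq]
        gcongr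
        exact hμ.lintegral_setLIntegral_separatedPairs_le hK hL.le (by positivity)
          measurable_pairCurvatureSq
    _ = ENNReal.ofReal (32 * K ^ 7 * L ^ 3 / η ^ 3) * totalCurvatureSq μ := by
        rw [← mul_assoc, ← ENNReal.ofReal_mul (by positivity)]
        congr 2
        simp only [A, c]
        field_simp
        norm_num

lemma ofReal_mul_le_measure_of_le_density {η : ℝ} (hη : 0 ≤ η)
    (h : ENNReal.ofReal η ≤ density μ x t) : ENNReal.ofReal (η * t) ≤ μ (closedBall x t) := by
  rw [ENNReal.ofReal_mul hη]
  exact ENNReal.mul_le_of_le_div h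

lemma exists_of_le_maxDensity {k₀ η δ : ℝ} (hη : 0 ≤ η) (hηδ : η < δ)
    (h : ENNReal.ofReal δ ≤ maxDensity μ k₀ x t) :
    ∃ y ∈ closedBall x (k₀ * t), ENNReal.ofReal (η * t) ≤ μ (closedBall y t) := by
  have hlt : ENNReal.ofReal η < maxDensity μ k₀ x t :=
    ((ENNReal.ofReal_lt_ofReal_iff_of_nonneg hη).2 hηδ).trans_le h
  simp only [maxDensity, lt_iSup_iff] at hlt
  obtain ⟨y, hyx, hy⟩ := hlt
  exact ⟨y, hyx, ofReal_mul_le_measure_of_le_density hη hy.le⟩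

end Beta

end Menger

theorem proposition2p4_general (k : ℝ) {L k₀ δ : ℝ} (hL : 0 < L) (hk₀ : 0 ≤ k₀) (hδ : 0 < δ) :
    ∃ C : NNReal, ∀ (n : ℕ) (μ : Measure (EuclideanSpace ℝ (Fin n))),
      Menger.HasLinearGrowth μ L →
      Menger.betaOneIntegral μ k (fun x => {s | ENNReal.ofReal δ ≤ Menger.density μ x s}) ≤
          C * Menger.totalCurvatureSq μ ∧
        Menger.betaOneIntegral μ k (fun x => {s | ENNReal.ofReal δ ≤ Menger.maxDensity μ k₀ x s}) ≤
          C * Menger.totalCurvatureSq μ := by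
  have hK : 0 < max k (k₀ + 1) := lt_max_of_lt_right (by positivity)
  refine ⟨Real.toNNReal (32 * max k (k₀ + 1) ^ 7 * L ^ 3 / (δ / 2) ^ 3), fun n μ hμ => ⟨?_, ?_⟩⟩
  · refine hμ.betaOneIntegral_le hL (half_pos hδ) hK (le_max_left _ _) (le_max_right _ _)
      fun x t hx ht => ⟨x, Metric.mem_closedBall_self (by positivity), ?_⟩
    exact Menger.ofReal_mul_le_measure_of_le_density (half_pos hδ).le
      ((ENNReal.ofReal_le_ofReal (half_le_self hδ.le)).trans hx)
  · exact hμ.betaOneIntegral_le hL (half_pos hδ) hK (le_max_left _ _) (le_max_right _ _)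
      fun x t hx _ => Menger.exists_of_le_maxDensity (half_pos hδ).le (half_lt_self hδ) hx

theorem proposition2p4 (n : ℕ) (C₀ k k₀ δ : ℝ)
    (hC₀ : 10 ≤ C₀) (hk : 1 < k) (hk₀ : 1 ≤ k₀) (hδ : 0 < δ) :
    ∃ C : NNReal, ∀ μ : Measure (EuclideanSpace ℝ (Fin n)),
      1 ≤ μ (Metric.closedBall 0 2) →
      μ (Metric.closedBall 0 2)ᶜ = 0 →
      (∀ (x : EuclideanSpace ℝ (Fin n)) (t : ℝ), 0 < t →
        μ (Metric.closedBall x t) ≤ ENNReal.ofReal (C₀ * (2 * t))) →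
      ((∫⁻ x, (∫⁻ t in Ioi (0 : ℝ),
          {s : ℝ | ENNReal.ofReal δ ≤ Menger.density μ x s}.indicator
            (fun s => Menger.betaOne μ k x s ^ 2 / ENNReal.ofReal s) t) ∂μ)
        ≤ C * Menger.totalCurvatureSq μ) ∧
      ((∫⁻ x, (∫⁻ t in Ioi (0 : ℝ),
          {s : ℝ | ENNReal.ofReal δ ≤ Menger.maxDensity μ k₀ x s}.indicator
            (fun s => Menger.betaOne μ k x s ^ 2 / ENNReal.ofReal s) t) ∂μ)
        ≤ C * Menger.totalCurvatureSq μ) := by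
  obtain ⟨C, hC⟩ := proposition2p4_general k (L := 2 * C₀) (k₀ := k₀) (by positivity)
    (by positivity) hδ
  exact ⟨C, fun μ _ _ hμ => hC n μ fun x t ht => (hμ x t ht).trans_eq (by ring_nf)⟩
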